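/- Let $X$ be a finite $T_0$-space. For $x\in X$ let $U_x$ be the intersection of all open sets containing $x$, and order $X$ by $x\le y$ if and only if $x\in U_y$. Let $C_X$ be the order complex of $(X,\le)$, that is, the simplicial complex whose simplices are the nonempty chains of $X$, and let $L$ be the simplicial complex whose simplices are the nonempty subsets of $X$ that have a common lower bound in $X$. Suppose that for all $x,y\in X$ the intersection $U_x\cap U_y$ is either empty or equal to $U_z$ for some $z\in X$. Then $C_X$ is a subcomplex of $L$, and the geometric realization $|C_X|$ is a (strong) deformation retract of $|L|$: there is a homotopy of maps $|L|\to|L|$, stationary on $|C_X|$, from the identity to a map with image in $|C_X|$. -/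

import Mathlib

namespace FiniteSpaces

/-- The minimal open set `U_x` of a point `x` of a finite space: the intersection of all
open sets that contain `x`. -/
def minimalOpen {X : Type*} [TopologicalSpace X] (x : X) : Set X :=
  ⋂₀ {U : Set X | IsOpen U ∧ x ∈ U}

/-- The partial order associated with a `T₀` topology: `x ≤ y` if and only if `x ∈ U_y`. -/
@[reducible]
def associatedOrder (X : Type*) [TopologicalSpace X] [T0Space X] : PartialOrder X where
  le x y := x ∈ minimalOpen y
  le_refl _ := fun _ hU => hU.2
  le_trans _ _ _ hxy hyz := fun U hU => hxy U ⟨hU.1, hyz U hU⟩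
  le_antisymm _ _ hxy hyx :=
    (inseparable_iff_forall_isOpen.2 fun U hU =>
      ⟨fun hx => hyx U ⟨hU, hx⟩, fun hy => hxy U ⟨hU, hy⟩⟩).eq

/-- The `L`-complex of a relation `R` between `X` and `Y`: its simplices are the nonempty finite
subsets of `Y` all of whose elements are related to a common element of `X`. -/
def relationLComplex {X Y : Type*} (R : X → Y → Prop) : PreAbstractSimplicialComplex Y where
  faces := {s | s.Nonempty ∧ ∃ x, ∀ y ∈ s, R x y}
  isRelLowerSet_faces := by
    rintro s ⟨hs, x, hx⟩
    exact ⟨hs, fun t hts ht => ⟨ht, x, fun y hy => hx y (hts hy)⟩⟩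

/-- The order complex of a poset: its simplices are the nonempty finite chains. -/
def orderComplex (P : Type*) [PartialOrder P] : PreAbstractSimplicialComplex P where
  faces := {s | s.Nonempty ∧ IsChain (· ≤ ·) (s : Set P)}
  isRelLowerSet_faces := by
    rintro s ⟨hs, hc⟩
    exact ⟨hs, fun t hts ht => ⟨ht, hc.mono (Finset.coe_subset.2 hts)⟩⟩

/-- The order complex `C_X` of a `T₀`-space `X`, regarded as a poset. -/
def spaceOrderComplex (X : Type*) [TopologicalSpace X] [T0Space X] :
    PreAbstractSimplicialComplex X :=
  @orderComplex X (associatedOrder X)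

/-- The `L`-complex of a `T₀`-space `X`: the `L`-complex of the relation `≤` on `X`. -/
def spaceLComplex (X : Type*) [TopologicalSpace X] [T0Space X] :
    PreAbstractSimplicialComplex X :=
  relationLComplex (associatedOrder X).le

/-- The geometric realization of a simplicial complex on a finite set `V`, in barycentric
coordinates: the points of the standard simplex of `V` whose support is a simplex of the complex.
It carries the subspace topology of the finite-dimensional space `V → ℝ`. -/
def realization {V : Type*} [Fintype V] (K : PreAbstractSimplicialComplex V) : Set (V → ℝ) :=
  {t | t ∈ stdSimplex ℝ V ∧ ∃ s ∈ K.faces, (s : Set V) = Function.support t}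

/-- `A ⊆ B` is a (strong) deformation retract of the space `B`: there is a homotopy of maps
`B → B`, stationary on `A`, from the identity to a map with values in `A` (which is therefore a
retraction of `B` onto `A`). -/
def IsDeformationRetract {E : Type*} [TopologicalSpace E] (A B : Set E) : Prop :=
  A ⊆ B ∧ ∃ r : C(B, B), (∀ b : B, (r b : E) ∈ A) ∧
    ContinuousMap.HomotopicRel (ContinuousMap.id B) r {b : B | (b : E) ∈ A}

end FiniteSpaces

/-!
Write `P` for `X` with its associated order. The hypothesis says that two elements of `P` with a
common lower bound have a greatest lower bound, hence so does every nonempty finite subset of `P`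
that is bounded below (`exists_isGLB_of_bddBelow`).

A retraction `|L| → |C_X|` is written down explicitly. For a point `t` of `|L|`, regarded as a
weight on `P`, let `g y` be the largest `t`-weight of a chain all of whose elements are `≤ y`, and
for `0 < λ ≤ M`, with `M` the largest weight of a chain, let `q λ` be the greatest lower bound
of the superlevel set `{y | λ ≤ g y}`; it is bounded below by any lower bound of the support of
`t`. Then `q` is a monotone step function of `λ`, so its values form a chain, and the retraction
sends `t` to the distribution of `q` under the uniform measure on `(0, M]`. If `t` is supported on a
chain, then `M = 1` and `q` is the quantile function of `t`, so `t` is fixed.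

Continuity comes from a formula for this distribution. Let `c x` be the largest weight of a chain
that has no element `≥ x` (`avoidingWeight`). Then `x ≤ q λ` if and only if `c x < λ`
(`exists_avoidingWeight_lt_iff`), so `q` takes the value `x` exactly on the interval
`(c x, min (M, min_{x' > x} c x')]` (`exists_forall_mem_Ioc_iff`), whose endpoints are continuous in
`t`. Adjoining a top element `⊤` to `P` makes `M = c ⊤`, and the right endpoint becomes
`min_{a > x} c a` (`nextWeight`).

Every value of `q` is above each lower bound of the support of `t`, so `t` and its image lie in a
common simplex of `L`, and the straight-line homotopy stays in `|L|`.
-/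

namespace FiniteSpaces

open Finset

/-! ### Straight-line deformation retractions -/

section Homotopy

/-- A continuous map of `B` into `A ⊆ B` that fixes `A` exhibits `A` as a deformation retract, via
the straight-line homotopy, as soon as every segment from a point to its image stays in `B`. -/
theorem isDeformationRetract_of_segment_subset {E : Type*} [AddCommGroup E] [Module ℝ E]
    [TopologicalSpace E] [IsTopologicalAddGroup E] [ContinuousSMul ℝ E] {A B : Set E} (hAB : A ⊆ B)
    (r : E → E) (hr : ContinuousOn r B) (hrA : ∀ b ∈ B, r b ∈ A) (hfix : ∀ a ∈ A, r a = a)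
    (hseg : ∀ b ∈ B, segment ℝ b (r b) ⊆ B) : IsDeformationRetract A B := by
  have hrc : Continuous fun b : B => r b := continuousOn_iff_continuous_domRestrict.1 hr
  refine ⟨hAB, ⟨fun b => ⟨r b, hAB (hrA b b.2)⟩, hrc.subtype_mk _⟩, fun b => hrA b b.2, ⟨?_⟩⟩
  refine
    { toFun := fun p => ⟨(1 - (p.1 : ℝ)) • (p.2 : E) + (p.1 : ℝ) • r p.2, ?_⟩
      continuous_toFun := ?_
      map_zero_left := fun b => by simp
      map_one_left := fun b => by simp
      prop' := fun s b hb => ?_ }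
  · exact hseg _ p.2.2 ⟨1 - p.1, p.1, by linarith [p.1.2.2], p.1.2.1, by ring, rfl⟩
  · have h2 : Continuous fun p : unitInterval × B => r p.2 := hrc.comp continuous_snd
    have h1 : Continuous fun p : unitInterval × B => (p.1 : ℝ) := by fun_prop
    have h3 : Continuous fun p : unitInterval × B => (p.2 : E) := by fun_prop
    exact (((continuous_const.sub h1).smul h3).add (h1.smul h2)).subtype_mk _
  · refine Subtype.ext ?_
    change (1 - (s : ℝ)) • (b : E) + (s : ℝ) • r b = b
    rw [hfix b hb, ← add_smul]
    simp

end Homotopy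

/-! ### Meets, chains and realizations in a finite poset -/

section Poset

variable {P : Type*} [PartialOrder P]

theorem exists_isGLB_of_bddBelow
    (hP : ∀ x y : P, (∃ w, w ≤ x ∧ w ≤ y) → ∃ z, IsGLB {x, y} z)
    {s : Finset P} (hs : s.Nonempty) (hb : BddBelow (s : Set P)) :
    ∃ q, IsGLB (s : Set P) q := by
  classical
  induction hs using Finset.Nonempty.cons_induction with
  | singleton a => exact ⟨a, by simp⟩
  | cons a s ha hs ih =>
    obtain ⟨w, hw⟩ := hb
    rw [coe_cons] at hw ⊢
    have hws : w ∈ lowerBounds (s : Set P) := fun y hy => hw (Set.mem_insert_of_mem _ hy)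
    obtain ⟨q, hq⟩ := ih ⟨w, hws⟩
    obtain ⟨z, hz⟩ := hP a q ⟨w, hw (Set.mem_insert _ _), hq.2 hws⟩
    refine ⟨z, fun y hy => ?_, fun v hv => hz.2 ?_⟩
    · rcases hy with rfl | hy
      · exact hz.1 (Set.mem_insert _ _)
      · exact (hz.1 (Set.mem_insert_of_mem _ rfl)).trans (hq.1 hy)
    · rintro y (rfl | rfl)
      · exact hv (Set.mem_insert _ _)
      · exact hq.2 fun y hy => hv (Set.mem_insert_of_mem _ hy)

theorem exists_forall_le_of_isChain {C : Finset P} (hC : IsChain (· ≤ ·) (C : Set P))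
    (hne : C.Nonempty) : ∃ y ∈ C, ∀ z ∈ C, z ≤ y := by
  obtain ⟨y, hy⟩ := C.exists_maximal hne
  exact ⟨y, hy.1, fun z hz => (hC.total hz hy.1).elim id fun h => hy.2 hz h⟩

theorem orderComplex_le_relationLComplex :
    orderComplex P ≤ relationLComplex ((· ≤ ·) : P → P → Prop) := by
  rintro s ⟨hne, hc⟩
  obtain ⟨m, hm⟩ := s.exists_minimal hne
  exact ⟨hne, m, fun y hy => (hc.total hm.1 hy).elim id fun h => hm.2 hy h⟩

variable [Fintype P]

theorem mem_realization_relationLComplex_iff {t : P → ℝ} :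
    t ∈ realization (relationLComplex ((· ≤ ·) : P → P → Prop)) ↔
      t ∈ stdSimplex ℝ P ∧ BddBelow (Function.support t) := by
  classical
  refine and_congr_right fun ht => ⟨?_, ?_⟩
  · rintro ⟨s, ⟨-, m, hm⟩, hs⟩
    exact ⟨m, fun y hy => hm y (by rwa [← mem_coe, hs])⟩
  · rintro ⟨m, hm⟩
    obtain ⟨x, -, hx⟩ := exists_ne_zero_of_sum_ne_zero (ht.2.trans_ne one_ne_zero)
    exact ⟨univ.filter (t · ≠ 0), ⟨⟨x, by simpa using hx⟩, m, fun y hy => hm (by simpa using hy)⟩,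
      by ext; simp⟩

theorem mem_realization_orderComplex_iff {t : P → ℝ} :
    t ∈ realization (orderComplex P) ↔
      t ∈ stdSimplex ℝ P ∧ IsChain (· ≤ ·) (Function.support t) := by
  classical
  refine and_congr_right fun ht => ⟨?_, fun h => ?_⟩
  · rintro ⟨s, ⟨-, hc⟩, hs⟩
    rwa [← hs]
  · obtain ⟨x, -, hx⟩ := exists_ne_zero_of_sum_ne_zero (ht.2.trans_ne one_ne_zero)
    have hs : ((univ.filter (t · ≠ 0) : Finset P) : Set P) = Function.support t := by ext; simp
    exact ⟨univ.filter (t · ≠ 0), ⟨⟨x, by simpa using hx⟩, by rwa [hs]⟩, hs⟩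

/-! ### Largest weights of chains -/

open Classical in
/-- The chains of `P` that have no element above `a`. The index `a = ⊤` imposes no condition. -/
noncomputable def chainsAvoiding (a : WithTop P) : Finset (Finset P) :=
  univ.filter fun C => IsChain (· ≤ ·) (C : Set P) ∧ ∀ y ∈ C, ¬ a ≤ (y : WithTop P)

theorem mem_chainsAvoiding {a : WithTop P} {C : Finset P} :
    C ∈ chainsAvoiding a ↔
      IsChain (· ≤ ·) (C : Set P) ∧ ∀ y ∈ C, ¬ a ≤ (y : WithTop P) := by
  simp [chainsAvoiding]

theorem empty_mem_chainsAvoiding (a : WithTop P) : ∅ ∈ chainsAvoiding a := by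
  simp [mem_chainsAvoiding]

/-- The largest `t`-weight of a chain of `P` that has no element above `a`. -/
noncomputable def avoidingWeight (t : P → ℝ) (a : WithTop P) : ℝ :=
  (chainsAvoiding a).sup' ⟨∅, empty_mem_chainsAvoiding a⟩ fun C => ∑ y ∈ C, t y

theorem sum_le_avoidingWeight (t : P → ℝ) {a : WithTop P} {C : Finset P}
    (hC : C ∈ chainsAvoiding a) : ∑ y ∈ C, t y ≤ avoidingWeight t a :=
  le_sup' (fun C => ∑ y ∈ C, t y) hC

theorem le_avoidingWeight_iff {t : P → ℝ} {a : WithTop P} {l : ℝ} :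
    l ≤ avoidingWeight t a ↔ ∃ C ∈ chainsAvoiding a, l ≤ ∑ y ∈ C, t y :=
  le_sup'_iff _

theorem avoidingWeight_nonneg (t : P → ℝ) (a : WithTop P) : 0 ≤ avoidingWeight t a := by
  simpa using sum_le_avoidingWeight t (empty_mem_chainsAvoiding a)

theorem avoidingWeight_mono (t : P → ℝ) : Monotone (avoidingWeight t) := by
  intro a b hab
  refine sup'_le _ _ fun C hC => sum_le_avoidingWeight t ?_
  rw [mem_chainsAvoiding] at hC ⊢
  exact ⟨hC.1, fun y hy h => hC.2 y hy (hab.trans h)⟩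

theorem continuous_avoidingWeight (a : WithTop P) :
    Continuous fun t : P → ℝ => avoidingWeight t a :=
  Continuous.finset_sup'_apply _ fun C _ => by fun_prop

theorem avoidingWeight_top_pos {t : P → ℝ} (ht : t ∈ stdSimplex ℝ P) :
    0 < avoidingWeight t ⊤ := by
  obtain ⟨x, -, hx⟩ := exists_ne_zero_of_sum_ne_zero (ht.2.trans_ne one_ne_zero)
  have h : ({x} : Finset P) ∈ chainsAvoiding (⊤ : WithTop P) := by simp [mem_chainsAvoiding]
  have := sum_le_avoidingWeight t h
  rw [sum_singleton] at this
  exact ((ht.1 x).lt_of_ne' hx).trans_le this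

open Classical in
/-- The least avoiding weight of an element of `WithTop P` strictly above `x`. -/
noncomputable def nextWeight (t : P → ℝ) (x : P) : ℝ :=
  (univ.filter fun a : WithTop P => (x : WithTop P) < a).inf' ⟨⊤, by simp⟩ (avoidingWeight t)

theorem le_nextWeight_iff {t : P → ℝ} {x : P} {l : ℝ} :
    l ≤ nextWeight t x ↔ ∀ a : WithTop P, (x : WithTop P) < a → l ≤ avoidingWeight t a :=
  (le_inf'_iff _ _).trans (by simp)

theorem nextWeight_le (t : P → ℝ) {x : P} {a : WithTop P} (h : (x : WithTop P) < a) :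
    nextWeight t x ≤ avoidingWeight t a :=
  le_nextWeight_iff.1 le_rfl a h

theorem avoidingWeight_le_nextWeight (t : P → ℝ) (x : P) :
    avoidingWeight t x ≤ nextWeight t x :=
  le_nextWeight_iff.2 fun _ h => avoidingWeight_mono t h.le

theorem continuous_nextWeight (x : P) : Continuous fun t : P → ℝ => nextWeight t x :=
  Continuous.finset_inf'_apply _ fun a _ => continuous_avoidingWeight a

/-! ### The step function of a weight -/

/-- The element `q` is the greatest lower bound of the set of all `y` such that some chain of
elements `≤ y` has weight at least `l`. -/
theorem exists_avoidingWeight_lt_iff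
    (hP : ∀ x y : P, (∃ w, w ≤ x ∧ w ≤ y) → ∃ z, IsGLB {x, y} z) {t : P → ℝ} {m : P}
    (hm : m ∈ lowerBounds (Function.support t)) {l : ℝ} (hl : 0 < l)
    (hl' : l ≤ avoidingWeight t ⊤) :
    ∃ q : P, m ≤ q ∧ ∀ x : P, avoidingWeight t x < l ↔ x ≤ q := by
  classical
  let A : Finset P := univ.filter fun y =>
    ∃ C : Finset P, IsChain (· ≤ ·) (C : Set P) ∧ (∀ z ∈ C, z ≤ y) ∧ l ≤ ∑ z ∈ C, t z
  have hA : ∀ y, y ∈ A ↔ ∃ C : Finset P,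
      IsChain (· ≤ ·) (C : Set P) ∧ (∀ z ∈ C, z ≤ y) ∧ l ≤ ∑ z ∈ C, t z := by simp [A]
  have htop : ∀ C : Finset P, IsChain (· ≤ ·) (C : Set P) → l ≤ ∑ z ∈ C, t z →
      ∃ y ∈ C, y ∈ A := by
    intro C hC hlC
    have hne : C.Nonempty := nonempty_of_sum_ne_zero (hl.trans_le hlC).ne'
    obtain ⟨y, hy, hle⟩ := exists_forall_le_of_isChain hC hne
    exact ⟨y, hy, (hA y).2 ⟨C, hC, hle, hlC⟩⟩
  have hmA : m ∈ lowerBounds (A : Set P) := by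
    intro y hy
    obtain ⟨C, -, hle, hlC⟩ := (hA y).1 hy
    obtain ⟨z, hz, hz0⟩ := exists_ne_zero_of_sum_ne_zero (hl.trans_le hlC).ne'
    exact (hm hz0).trans (hle z hz)
  have hne : A.Nonempty := by
    obtain ⟨C, hC, hlC⟩ := le_avoidingWeight_iff.1 hl'
    obtain ⟨y, -, hy⟩ := htop C (mem_chainsAvoiding.1 hC).1 hlC
    exact ⟨y, hy⟩
  obtain ⟨q, hq⟩ := exists_isGLB_of_bddBelow hP hne ⟨m, hmA⟩
  refine ⟨q, hq.2 hmA, fun x => ?_⟩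
  rw [le_isGLB_iff hq, ← not_le, le_avoidingWeight_iff]
  constructor
  · intro h y hy
    by_contra hxy
    obtain ⟨C, hC, hle, hlC⟩ := (hA y).1 hy
    exact h ⟨C, mem_chainsAvoiding.2
      ⟨hC, fun z hz hxz => hxy ((WithTop.coe_le_coe.1 hxz).trans (hle z hz))⟩, hlC⟩
  · rintro h ⟨C, hC, hlC⟩
    obtain ⟨hC, hav⟩ := mem_chainsAvoiding.1 hC
    obtain ⟨y, hy, hyA⟩ := htop C hC hlC
    exact hav y hy (WithTop.coe_le_coe.2 (h hyA))

/-- Every level `l` in `(0, M]` lies in exactly one of the intervals attached to the elements of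
`P`. -/
theorem exists_forall_mem_Ioc_iff
    (hP : ∀ x y : P, (∃ w, w ≤ x ∧ w ≤ y) → ∃ z, IsGLB {x, y} z) {t : P → ℝ} {m : P}
    (hm : m ∈ lowerBounds (Function.support t)) {l : ℝ}
    (hl : l ∈ Set.Ioc 0 (avoidingWeight t ⊤)) :
    ∃ q : P, m ≤ q ∧ (∀ x : P, avoidingWeight t x < l ↔ x ≤ q) ∧
      ∀ x : P, l ∈ Set.Ioc (avoidingWeight t x) (nextWeight t x) ↔ x = q := by
  obtain ⟨q, hmq, hq⟩ := exists_avoidingWeight_lt_iff hP hm hl.1 hl.2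
  refine ⟨q, hmq, hq, fun x => ⟨fun ⟨h1, h2⟩ => ?_, ?_⟩⟩
  · refine ((hq x).1 h1).eq_of_not_lt fun hlt => ?_
    have := nextWeight_le t (WithTop.coe_lt_coe.2 hlt)
    exact absurd ((hq q).2 le_rfl) (h2.trans this).not_gt
  · rintro rfl
    refine ⟨(hq x).2 le_rfl, le_nextWeight_iff.2 fun a ha => ?_⟩
    induction a with
    | top => exact hl.2
    | coe a => exact not_lt.1 fun h => (WithTop.coe_lt_coe.1 ha).not_ge ((hq a).1 h)

theorem Ioc_avoidingWeight_nextWeight_subset (t : P → ℝ) (x : P) :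
    Set.Ioc (avoidingWeight t x) (nextWeight t x) ⊆ Set.Ioc 0 (avoidingWeight t ⊤) :=
  Set.Ioc_subset_Ioc (avoidingWeight_nonneg t x) (nextWeight_le t (WithTop.coe_lt_top x))

theorem sum_nextWeight_sub_avoidingWeight
    (hP : ∀ x y : P, (∃ w, w ≤ x ∧ w ≤ y) → ∃ z, IsGLB {x, y} z) {t : P → ℝ}
    (hb : BddBelow (Function.support t)) :
    ∑ x, (nextWeight t x - avoidingWeight t x) = avoidingWeight t ⊤ := by
  obtain ⟨m, hm⟩ := hb
  -- The lengths of the pairwise disjoint intervals covering `(0, M]` add up to `M`.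
  have hU : ⋃ x ∈ (univ : Finset P), Set.Ioc (avoidingWeight t x) (nextWeight t x) =
      Set.Ioc 0 (avoidingWeight t ⊤) := by
    refine Set.Subset.antisymm
      (Set.iUnion₂_subset fun x _ => Ioc_avoidingWeight_nextWeight_subset t x) fun l hl => ?_
    obtain ⟨q, -, -, hq⟩ := exists_forall_mem_Ioc_iff hP hm hl
    exact Set.mem_iUnion₂.2 ⟨q, mem_univ q, (hq q).2 rfl⟩
  have hd : Set.PairwiseDisjoint ((univ : Finset P) : Set P)
      fun x : P => Set.Ioc (avoidingWeight t x) (nextWeight t x) := by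
    intro x _ y _ hxy
    refine Set.disjoint_left.2 fun l hx hy => hxy ?_
    obtain ⟨q, -, -, hq⟩ :=
      exists_forall_mem_Ioc_iff hP hm (Ioc_avoidingWeight_nextWeight_subset t x hx)
    exact ((hq x).1 hx).trans ((hq y).1 hy).symm
  have h := MeasureTheory.measureReal_biUnion_finset (μ := MeasureTheory.volume) hd
    (fun _ _ => measurableSet_Ioc) fun _ _ => measure_Ioc_lt_top.ne
  rw [hU, Real.volume_real_Ioc_of_le (avoidingWeight_nonneg t ⊤), sub_zero] at h
  rw [h]
  exact sum_congr rfl fun x _ =>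
    (Real.volume_real_Ioc_of_le (avoidingWeight_le_nextWeight t x)).symm

/-! ### Weights supported on a chain -/

open Classical in
theorem avoidingWeight_eq_sum {t : P → ℝ} (h0 : ∀ y, 0 ≤ t y)
    (hc : IsChain (· ≤ ·) (Function.support t)) (a : WithTop P) :
    avoidingWeight t a = ∑ y with ¬ a ≤ ((y : P) : WithTop P), t y := by
  apply le_antisymm
  · refine sup'_le _ _ fun C hC => sum_le_sum_of_subset_of_nonneg (fun y hy => ?_)
      fun y _ _ => h0 y
    simpa using (mem_chainsAvoiding.1 hC).2 y hy
  · rw [← sum_filter_ne_zero]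
    refine sum_le_avoidingWeight t (mem_chainsAvoiding.2 ⟨hc.mono fun y hy => ?_, fun y hy => ?_⟩)
    · simp only [coe_filter, Set.mem_ofPred_eq] at hy
      exact hy.2
    · simp only [mem_filter] at hy
      exact hy.1.2

open Classical in
theorem nextWeight_eq_sum {t : P → ℝ} (h0 : ∀ y, 0 ≤ t y)
    (hc : IsChain (· ≤ ·) (Function.support t)) (x : P) :
    nextWeight t x = ∑ y with ¬ x < y, t y := by
  apply le_antisymm
  · -- The minimum is attained at the least element of the support above `x`, or else at `⊤`.
    have key : ∃ a : WithTop P, (x : WithTop P) < a ∧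
        ∀ y, t y ≠ 0 → x < y → a ≤ (y : WithTop P) := by
      by_cases hne : (univ.filter fun y => t y ≠ 0 ∧ x < y).Nonempty
      · obtain ⟨a, ha⟩ := (univ.filter fun y => t y ≠ 0 ∧ x < y).exists_minimal hne
        have ha1 : t a ≠ 0 ∧ x < a := by simpa using ha.1
        refine ⟨a, WithTop.coe_lt_coe.2 ha1.2, fun y hy hxy => WithTop.coe_le_coe.2 ?_⟩
        exact (hc.total ha1.1 hy).elim id fun h => ha.2 (by simpa using ⟨hy, hxy⟩) h
      · refine ⟨⊤, WithTop.coe_lt_top x, fun y hy hxy => (hne ⟨y, by simpa using ⟨hy, hxy⟩⟩).elim⟩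
    obtain ⟨a, hxa, ha⟩ := key
    refine (nextWeight_le t hxa).trans ?_
    rw [avoidingWeight_eq_sum h0 hc, ← sum_filter_ne_zero]
    refine sum_le_sum_of_subset_of_nonneg (fun y hy => ?_) fun y _ _ => h0 y
    simp only [mem_filter, mem_univ, true_and] at hy ⊢
    exact fun h => hy.1 (ha y hy.2 h)
  · refine le_nextWeight_iff.2 fun a hxa => ?_
    rw [avoidingWeight_eq_sum h0 hc]
    refine sum_le_sum_of_subset_of_nonneg (fun y hy => ?_) fun y _ _ => h0 y
    simp only [mem_filter, mem_univ, true_and] at hy ⊢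
    exact fun h => hy (WithTop.coe_lt_coe.1 (hxa.trans_le h))

/-! ### The retraction -/

/-- The distribution, under the uniform measure on `(0, M]`, of the step function that takes the
value `x` on the interval from `avoidingWeight t x` to `nextWeight t x`. Here
`M = avoidingWeight t ⊤` is the largest weight of a chain. -/
noncomputable def chainRetraction (t : P → ℝ) (x : P) : ℝ :=
  (nextWeight t x - avoidingWeight t x) / avoidingWeight t ⊤

theorem continuousOn_chainRetraction :
    ContinuousOn (chainRetraction (P := P)) (stdSimplex ℝ P) := by
  refine continuousOn_pi.2 fun x => ?_
  have hn : Continuous fun t : P → ℝ => nextWeight t x - avoidingWeight t x :=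
    (continuous_nextWeight x).sub (continuous_avoidingWeight (x : WithTop P))
  exact hn.continuousOn.div (continuous_avoidingWeight ⊤).continuousOn
    fun t ht => (avoidingWeight_top_pos ht).ne'

theorem chainRetraction_eq_self {t : P → ℝ} (ht : t ∈ realization (orderComplex P)) :
    chainRetraction t = t := by
  classical
  obtain ⟨ht, hc⟩ := mem_realization_orderComplex_iff.1 ht
  funext x
  have hM : avoidingWeight t ⊤ = 1 := by
    rw [avoidingWeight_eq_sum ht.1 hc, ← ht.2]
    simp
  have hx : univ.filter (fun y => ¬ x < y) = insert x (univ.filter fun y => ¬ x ≤ y) := by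
    ext y
    simp only [mem_filter, mem_univ, true_and, mem_insert, lt_iff_le_and_ne, ne_eq, not_and,
      not_not]
    grind
  rw [chainRetraction, hM, div_one, nextWeight_eq_sum ht.1 hc, avoidingWeight_eq_sum ht.1 hc, hx,
    sum_insert (by simp)]
  simp

theorem avoidingWeight_lt_nextWeight {t : P → ℝ} {x : P} (hx : chainRetraction t x ≠ 0) :
    avoidingWeight t x < nextWeight t x :=
  (avoidingWeight_le_nextWeight t x).lt_of_ne fun h => hx (by simp [chainRetraction, h])

theorem chainRetraction_mem_stdSimplex
    (hP : ∀ x y : P, (∃ w, w ≤ x ∧ w ≤ y) → ∃ z, IsGLB {x, y} z) {t : P → ℝ}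
    (ht : t ∈ stdSimplex ℝ P) (hb : BddBelow (Function.support t)) :
    chainRetraction t ∈ stdSimplex ℝ P := by
  refine ⟨fun x => div_nonneg (sub_nonneg.2 (avoidingWeight_le_nextWeight t x))
    (avoidingWeight_nonneg t ⊤), ?_⟩
  simp only [chainRetraction]
  rw [← sum_div, sum_nextWeight_sub_avoidingWeight hP hb, div_self (avoidingWeight_top_pos ht).ne']

/-- If `y` is in the support and the avoiding weight of `x` is at most that of `y`, then at the right
endpoint of the interval of `y` the step function takes the value `y`, and `x` is below it. -/
theorem isChain_support_chainRetraction
    (hP : ∀ x y : P, (∃ w, w ≤ x ∧ w ≤ y) → ∃ z, IsGLB {x, y} z) {t : P → ℝ}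
    (hb : BddBelow (Function.support t)) :
    IsChain (· ≤ ·) (Function.support (chainRetraction t)) := by
  obtain ⟨m, hm⟩ := hb
  have key : ∀ x y : P, chainRetraction t y ≠ 0 → avoidingWeight t x ≤ avoidingWeight t y →
      x ≤ y := by
    intro x y hy hxy
    have hy := Set.right_mem_Ioc.2 (avoidingWeight_lt_nextWeight hy)
    obtain ⟨q, -, hq, hq'⟩ :=
      exists_forall_mem_Ioc_iff hP hm (Ioc_avoidingWeight_nextWeight_subset t y hy)
    rw [(hq' y).1 hy]
    exact (hq x).1 (hxy.trans_lt hy.1)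
  intro x hx y hy _
  exact (le_total (avoidingWeight t x) (avoidingWeight t y)).imp (key x y hy) (key y x hx)

theorem lowerBounds_support_subset
    (hP : ∀ x y : P, (∃ w, w ≤ x ∧ w ≤ y) → ∃ z, IsGLB {x, y} z) (t : P → ℝ) :
    lowerBounds (Function.support t) ⊆ lowerBounds (Function.support (chainRetraction t)) := by
  intro m hm x hx
  have hx := Set.right_mem_Ioc.2 (avoidingWeight_lt_nextWeight hx)
  obtain ⟨q, hmq, -, hq⟩ :=
    exists_forall_mem_Ioc_iff hP hm (Ioc_avoidingWeight_nextWeight_subset t x hx)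
  rwa [(hq x).1 hx]

theorem isDeformationRetract_realization_orderComplex
    (hP : ∀ x y : P, (∃ w, w ≤ x ∧ w ≤ y) → ∃ z, IsGLB {x, y} z) :
    IsDeformationRetract (realization (orderComplex P))
      (realization (relationLComplex ((· ≤ ·) : P → P → Prop))) := by
  refine isDeformationRetract_of_segment_subset ?_ chainRetraction
    (continuousOn_chainRetraction.mono fun t ht => ht.1) ?_ (fun t => chainRetraction_eq_self) ?_
  · rintro t ⟨ht, s, hs, hst⟩
    exact ⟨ht, s, orderComplex_le_relationLComplex hs, hst⟩
  · intro t ht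
    obtain ⟨ht, hb⟩ := mem_realization_relationLComplex_iff.1 ht
    exact mem_realization_orderComplex_iff.2
      ⟨chainRetraction_mem_stdSimplex hP ht hb, isChain_support_chainRetraction hP hb⟩
  · intro t ht u hu
    obtain ⟨ht, m, hm⟩ := mem_realization_relationLComplex_iff.1 ht
    refine mem_realization_relationLComplex_iff.2 ⟨(convex_stdSimplex ℝ P).segment_subset ht
      (chainRetraction_mem_stdSimplex hP ht ⟨m, hm⟩) hu, m, fun y hy => ?_⟩
    obtain ⟨a, b, -, -, -, rfl⟩ := hu
    by_cases hty : t y = 0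
    · refine lowerBounds_support_subset hP t hm fun hry => hy ?_
      simp [hty, hry]
    · exact hm hty

end Poset

end FiniteSpaces

theorem mainTheorem8 (X : Type*) [Fintype X] [TopologicalSpace X] [T0Space X]
    (hX : ∀ x y : X,
      FiniteSpaces.minimalOpen x ∩ FiniteSpaces.minimalOpen y = ∅ ∨
        ∃ z : X, FiniteSpaces.minimalOpen x ∩ FiniteSpaces.minimalOpen y =
          FiniteSpaces.minimalOpen z) :
    FiniteSpaces.spaceOrderComplex X ≤ FiniteSpaces.spaceLComplex X ∧
      FiniteSpaces.IsDeformationRetract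
        (FiniteSpaces.realization (FiniteSpaces.spaceOrderComplex X))
        (FiniteSpaces.realization (FiniteSpaces.spaceLComplex X)) := by
  let := FiniteSpaces.associatedOrder X
  refine ⟨FiniteSpaces.orderComplex_le_relationLComplex,
    FiniteSpaces.isDeformationRetract_realization_orderComplex ?_⟩
  rintro x y ⟨w, hwx, hwy⟩
  rcases hX x y with h | ⟨z, hz⟩
  · exact absurd (show w ∈ FiniteSpaces.minimalOpen x ∩ FiniteSpaces.minimalOpen y from ⟨hwx, hwy⟩)
      (by simp [h])
  · -- Membership in `U_z` is the relation `≤ z`, so the hypothesis makes `z` a meet of `x`, `y`.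
    have hle : ∀ v : X, v ≤ z ↔ v ≤ x ∧ v ≤ y := fun v => (Set.ext_iff.1 hz v).symm
    refine ⟨z, ?_, fun v hv => (hle v).2 ⟨hv (Set.mem_insert _ _), hv (Set.mem_insert_of_mem _ rfl)⟩⟩
    rintro v (rfl | rfl)
    · exact ((hle z).1 le_rfl).1
    · exact ((hle z).1 le_rfl).2
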